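/- Let $\{Z_t\}_{t\in\mathbb{Z}}$ be i.i.d. real random variables with mean $0$ and variance $1$, let $\theta,\gamma,\omega,d\in\mathbb{R}$, let $s\ge 1$ be an integer, and put $g(Z_t)=\theta Z_t+\gamma\,(|Z_t|-\mathbb{E}|Z_t|)$. Let $\alpha,\beta$ be real polynomials with $\alpha(0)=\beta(0)=1$, without common complex roots, with $\beta(z)\neq 0$ for all complex $|z|\le 1$. Define $\lambda_{d,k}$, $k\ge 0$, by $$\frac{\alpha(z)}{\beta(z)}(1-z^s)^{-d}=\sum_{k=0}^\infty \lambda_{d,k}z^k,\qquad |z|<1,$$ and, for $t\in\mathbb{Z}$, consider the series $$\ln(\sigma_t^2)-\omega=\sum_{k=0}^\infty \lambda_{d,k}\,g(Z_{t-1-k}).\qquad (*)$$ An SFIEGARCH process driven by $\{Z_t\}$ is a process $X_t=\sigma_tZ_t$, $t\in\mathbb{Z}$, with random variables $\sigma_t>0$ such that, for every $t$, almost surely $(*)$ converges to $\ln(\sigma_t^2)-\omega$. (i) If $d<1/2$, then for every $t$ the series $(*)$ converges almost surely, and an SFIEGARCH process driven by $\{Z_t\}$ exists. (ii) Suppose in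 addition that $\operatorname{Var}(g(Z_0))>0$ and that $\alpha$ does not vanish at all the $s$-th roots of unity (for example, $\alpha(1)\neq 0$). Then, for each $t$, the series $(*)$ converges almost surely if and only if $d<1/2$; and an SFIEGARCH process driven by $\{Z_t\}$ exists if and only if $d<1/2$. (iii) If $d\le 0$, then for every $t$ the series $(*)$ converges absolutely almost surely. -/

import Mathlib

open MeasureTheory ProbabilityTheory Filter Topology
open scoped Polynomial PowerSeries

noncomputable section

namespace SFIEGARCH

/-- The `k`-th Maclaurin coefficient of `(1 - z)⁻ᵈ`, that is `d (d + 1) ⋯ (d + k - 1) / k!`.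
This is `Γ(k + d) / (Γ(k + 1) Γ(d))` whenever `d` is not a pole of `Γ`, and its usual continuous
extension when `d = 0, -1, -2, …`. -/
def fracCoeff (d : ℝ) (k : ℕ) : ℝ :=
  (∏ i ∈ Finset.range k, (d + i)) / (Nat.factorial k : ℝ)

theorem fracCoeff_eq_Gamma (d : ℝ) (hd : ∀ n : ℕ, d ≠ -n) (k : ℕ) :
    fracCoeff d k = Real.Gamma (k + d) / (Real.Gamma (k + 1) * Real.Gamma d) := by
  have h : ∀ k : ℕ, Real.Gamma (k + d) = (∏ i ∈ Finset.range k, (d + i)) * Real.Gamma d := by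
    intro k
    induction k with
    | zero => simp
    | succ k ih =>
      have hk : (k : ℝ) + d ≠ 0 := fun h0 => hd k (by linarith)
      rw [Finset.prod_range_succ,
        show ((k + 1 : ℕ) : ℝ) + d = (k + d) + 1 by push_cast; ring,
        Real.Gamma_add_one hk, ih]
      ring
  have hG : Real.Gamma d ≠ 0 := Real.Gamma_ne_zero hd
  rw [fracCoeff, h, Real.Gamma_nat_eq_factorial]
  field_simp

/-- The power series `(1 - X ^ s)⁻ᵈ`: its coefficient at `k` is `fracCoeff d (k / s)` when `s ∣ k`,
and `0` otherwise. -/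
def seasonalSeries (d : ℝ) (s : ℕ) : ℝ⟦X⟧ :=
  PowerSeries.mk fun k => if s ∣ k then fracCoeff d (k / s) else 0

/-- The power series of `λ(z) = α(z) / β(z) * (1 - z ^ s)⁻ᵈ` at the origin. -/
def lambdaSeries (α β : ℝ[X]) (d : ℝ) (s : ℕ) : ℝ⟦X⟧ :=
  (α : ℝ⟦X⟧) * (β : ℝ⟦X⟧)⁻¹ * seasonalSeries d s

/-- The coefficients `λ_{d,k}`. -/
def lam (α β : ℝ[X]) (d : ℝ) (s : ℕ) (k : ℕ) : ℝ :=
  PowerSeries.coeff k (lambdaSeries α β d s)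

variable {Ω : Type*} [MeasurableSpace Ω]

/-- `Z` is a sequence, indexed by `ℤ`, of i.i.d. random variables with zero mean and
variance one. -/
structure IsInnovation (Z : ℤ → Ω → ℝ) (μ : Measure Ω) : Prop where
  measurable : ∀ t, Measurable (Z t)
  indep : iIndepFun Z μ
  identDistrib : ∀ t, IdentDistrib (Z t) (Z 0) μ μ
  memLp : ∀ t, MemLp (Z t) 2 μ
  mean : ∀ t, ∫ x, Z t x ∂μ = 0
  variance : ∀ t, variance (Z t) μ = 1

/-- `g(Z_t) = θ Z_t + γ (|Z_t| - E|Z_t|)`. -/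
def gNoise (μ : Measure Ω) (Z : ℤ → Ω → ℝ) (θ γ : ℝ) (t : ℤ) (x : Ω) : ℝ :=
  θ * Z t x + γ * (|Z t x| - ∫ y, |Z t y| ∂μ)

/-- The `k`-th term `λ_{d,k} g(Z_{t-1-k})` of the series for `ln(σ_t²) - ω`. -/
def logVolTerm (μ : Measure Ω) (Z : ℤ → Ω → ℝ) (α β : ℝ[X]) (s : ℕ) (d θ γ : ℝ)
    (t : ℤ) (k : ℕ) (x : Ω) : ℝ :=
  lam α β d s k * gNoise μ Z θ γ (t - 1 - k) x

/-- The real series `∑ a_k` converges to `l` (limit of its partial sums, in the given order). -/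
def SeriesTendsto (a : ℕ → ℝ) (l : ℝ) : Prop :=
  Tendsto (fun n => ∑ k ∈ Finset.range n, a k) atTop (𝓝 l)

/-- `X` is an SFIEGARCH process driven by `Z`: `X_t = σ_t Z_t`, where `σ_t > 0` and `ln(σ_t²) - ω`
is the sum of the (almost surely convergent) series `∑ λ_{d,k} g(Z_{t-1-k})`. -/
def IsSFIEGARCH (μ : Measure Ω) (Z : ℤ → Ω → ℝ) (α β : ℝ[X]) (s : ℕ) (d θ γ ω : ℝ)
    (X : ℤ → Ω → ℝ) : Prop :=
  (∀ t, Measurable (X t)) ∧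
  ∃ σ : ℤ → Ω → ℝ, (∀ t, Measurable (σ t)) ∧
    ∀ t, ∀ᵐ x ∂μ, 0 < σ t x ∧ X t x = σ t x * Z t x ∧
      SeriesTendsto (fun k => logVolTerm μ Z α β s d θ γ t k x) (Real.log (σ t x ^ 2) - ω)

end SFIEGARCH

end

/-! The terms of the series are independent and centered, with variances proportional to `λ_k²`, so
everything depends on whether `∑ λ_k²` is finite. If it is, the partial sums are an L²-bounded
martingale and converge almost surely (`ae_exists_tendsto_sum`). Conversely, almost sure convergence
with non-degenerate noise keeps the product of the characteristic functions of the terms away from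
zero near the origin, while all but finitely many factors are at most `exp (-c u² λ_k²)`; hence `∑
λ_k² < ∞` (`summable_sq_of_ae_tendsto`).

On the analytic side, `α / β` has ℓ¹ coefficients because `β` has no zeros in the closed disc, so
Young's inequality carries square-summability over from `(1 - z ^ s)⁻ᵈ` when `d < 1/2`
(`summable_sq_lam`). For `d ≥ 1/2` (`not_summable_sq_lam`), multiplying by `β` leaves `α(z) (1 - z ^
s)⁻ᵈ`. Along a residue class mod `s` in which the coefficients of `α` have sum `A ≠ 0`, its
coefficients are asymptotic to `A * fracCoeff d q`, which is not square-summable.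

For `d ≤ 0` the `λ_k` are themselves ℓ¹, and integrability of `g(Z_0)` gives absolute convergence.
-/

namespace SFIEGARCH

/-! ### Summability of the coefficients of `(1 - z)⁻ᵈ` -/

/-- A form of Raabe's test for convergence. -/
theorem summable_of_raabe {u : ℕ → ℝ} (hu : ∀ k, 0 ≤ u k) {c : ℝ} (hc : 0 < c) (N : ℕ)
    (h : ∀ k, N ≤ k → (k + 1 : ℝ) * u (k + 1) ≤ (k - c) * u k) : Summable u := by
  rw [← summable_nat_add_iff N]
  -- The hypothesis reads `c * u k ≤ k * u k - (k + 1) * u (k + 1)`, which telescopes.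
  have key : ∀ n, c * ∑ i ∈ Finset.range n, u (i + N) ≤
      N * u N - (n + N : ℝ) * u (n + N) := by
    intro n
    induction n with
    | zero => simp
    | succ n ih =>
      have := h (n + N) (by omega)
      rw [Finset.sum_range_succ, mul_add, show n + 1 + N = n + N + 1 by ring]
      push_cast at this ⊢
      linarith
  refine summable_of_sum_range_le (c := N * u N / c) (fun n => hu _) fun n => ?_
  rw [le_div_iff₀ hc]
  have h1 := key n
  have h2 : 0 ≤ (n + N : ℝ) * u (n + N) := mul_nonneg (by positivity) (hu _)
  linarith

theorem fracCoeff_succ (d : ℝ) (k : ℕ) :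
    (k + 1 : ℝ) * fracCoeff d (k + 1) = (d + k) * fracCoeff d k := by
  have : (Nat.factorial k : ℝ) ≠ 0 := by positivity
  have : (k + 1 : ℝ) ≠ 0 := by positivity
  rw [fracCoeff, fracCoeff, Finset.prod_range_succ, Nat.factorial_succ]
  push_cast
  field_simp

theorem summable_abs_fracCoeff {d : ℝ} (hd : d ≤ 0) : Summable fun k => |fracCoeff d k| := by
  rcases hd.eq_or_lt with rfl | hd
  · refine summable_of_ne_finset_zero (s := {0}) fun k hk => ?_
    rw [Finset.mem_singleton] at hk
    rw [fracCoeff, Finset.prod_eq_zero (i := 0) (by simpa using Nat.pos_of_ne_zero hk) (by simp)]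
    simp
  · obtain ⟨N, hN⟩ := exists_nat_ge (-d)
    refine summable_of_raabe (fun _ => abs_nonneg _) (neg_pos.2 hd) N fun k hk => ?_
    have hk' : (N : ℝ) ≤ k := by exact_mod_cast hk
    have h1 := congrArg abs (fracCoeff_succ d k)
    rw [abs_mul, abs_mul, abs_of_nonneg (by positivity : (0 : ℝ) ≤ k + 1),
      abs_of_nonneg (by linarith : (0 : ℝ) ≤ d + k)] at h1
    linarith

theorem summable_sq_fracCoeff {d : ℝ} (hd : d < 1 / 2) : Summable fun k => fracCoeff d k ^ 2 := by
  -- The natural Raabe constant for the squares is `1 - 2d`; half of it is given up to absorb the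
  -- lower-order term `d² + c` once `k ≥ N`.
  set c := (1 - 2 * d) / 2 with hc
  have hc0 : 0 < c := by rw [hc]; linarith
  obtain ⟨N, hN⟩ := exists_nat_ge ((d ^ 2 + c) / c)
  refine summable_of_raabe (fun _ => sq_nonneg _) hc0 N fun k hk => ?_
  have hk' : (N : ℝ) ≤ k := by exact_mod_cast hk
  have hk2 : d ^ 2 + c ≤ k * c := by
    rw [← div_le_iff₀ hc0]; linarith
  have hpos : (0 : ℝ) < k + 1 := by positivity
  have h1 := fracCoeff_succ d k
  have h2 : (k + 1 : ℝ) * ((k + 1 : ℝ) * fracCoeff d (k + 1) ^ 2) =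
      (d + k) ^ 2 * fracCoeff d k ^ 2 := by
    rw [← mul_pow, ← h1]; ring
  refine le_of_mul_le_mul_left ?_ hpos
  rw [h2, ← mul_assoc]
  refine mul_le_mul_of_nonneg_right ?_ (sq_nonneg _)
  have : 2 * d = 1 - 2 * c := by rw [hc]; ring
  have h3 : 2 * d * k = (1 - 2 * c) * k := by rw [this]
  nlinarith

theorem fracCoeff_pos {d : ℝ} (hd : 0 < d) (k : ℕ) : 0 < fracCoeff d k := by
  refine div_pos (Finset.prod_pos fun i _ => by positivity) (by positivity)

theorem not_summable_sq_fracCoeff {d : ℝ} (hd : 1 / 2 ≤ d) :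
    ¬ Summable fun k => fracCoeff d k ^ 2 := by
  -- For `d ≥ 1/2` the sequence `k * fracCoeff d k ^ 2` is nondecreasing from `k = 1`, where it
  -- equals `d²`; the harmonic series then gives divergence.
  have key : ∀ k : ℕ, 1 / 4 ≤ (k + 1 : ℝ) * fracCoeff d (k + 1) ^ 2 := by
    intro k
    induction k with
    | zero =>
      simp [fracCoeff]
      nlinarith
    | succ k ih =>
      refine ih.trans ?_
      have h1 := fracCoeff_succ d (k + 1)
      have hpos : (0 : ℝ) < k + 1 + 1 := by positivity
      push_cast at h1 ⊢
      have h2 : (k + 1 + 1 : ℝ) * ((k + 1 + 1 : ℝ) * fracCoeff d (k + 1 + 1) ^ 2) =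
          (d + (k + 1)) ^ 2 * fracCoeff d (k + 1) ^ 2 := by
        rw [← mul_pow, ← h1]; ring
      refine le_of_mul_le_mul_left ?_ hpos
      rw [h2, ← mul_assoc]
      refine mul_le_mul_of_nonneg_right ?_ (sq_nonneg _)
      have : (0 : ℝ) ≤ k := by positivity
      nlinarith
  intro h
  have h1 : Summable fun k : ℕ => 1 / ((k : ℝ) + 1) := by
    refine Summable.of_nonneg_of_le (fun k => by positivity) (fun k => ?_)
      (((summable_nat_add_iff 1).2 h).mul_left 4)
    rw [div_le_iff₀ (by positivity)]
    linarith [key k]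
  have h2 := (summable_nat_add_iff (f := fun k : ℕ => 1 / (k : ℝ)) 1).1 (by simpa using h1)
  exact Real.not_summable_one_div_natCast h2

/-! ### Convolution and reciprocals of polynomials -/

/-- Young's inequality `ℓ¹ * ℓ² ⊆ ℓ²` for the convolution of one-sided sequences. -/
theorem summable_sq_sum_antidiagonal {a b : ℕ → ℝ} (ha : Summable fun k => |a k|)
    (hb : Summable fun k => b k ^ 2) :
    Summable fun n => (∑ p ∈ Finset.HasAntidiagonal.antidiagonal n, a p.1 * b p.2) ^ 2 := by
  have h := summable_norm_sum_mul_antidiagonal_of_summable_norm (f := fun k => |a k|)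
    (g := fun k => b k ^ 2) (by simpa using ha) (by simpa using hb)
  refine Summable.of_nonneg_of_le (fun _ => sq_nonneg _) (fun n => ?_)
    (h.mul_left (∑' k, |a k|))
  calc (∑ p ∈ Finset.HasAntidiagonal.antidiagonal n, a p.1 * b p.2) ^ 2
      ≤ (∑ p ∈ Finset.HasAntidiagonal.antidiagonal n, |a p.1|) *
        ∑ p ∈ Finset.HasAntidiagonal.antidiagonal n, |a p.1| * b p.2 ^ 2 := by
        refine Finset.sum_sq_le_sum_mul_sum_of_sq_le_mul _ (fun _ _ => abs_nonneg _)
          (fun _ _ => by positivity) fun p _ => ?_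
        rw [mul_pow, ← sq_abs (a p.1)]
        exact le_of_eq (by ring)
    _ ≤ _ := by
        refine mul_le_mul ?_ (le_abs_self _) (Finset.sum_nonneg fun _ _ => by positivity)
          (tsum_nonneg fun _ => abs_nonneg _)
        rw [Finset.Nat.sum_antidiagonal_eq_sum_range_succ_mk]
        exact ha.sum_le_tsum _ fun _ _ => abs_nonneg _

theorem summable_norm_coeff_mul {R : Type*} [NormedCommRing R] {φ ψ : R⟦X⟧}
    (hφ : Summable fun k => ‖PowerSeries.coeff k φ‖)
    (hψ : Summable fun k => ‖PowerSeries.coeff k ψ‖) :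
    Summable fun k => ‖PowerSeries.coeff k (φ * ψ)‖ := by
  simp_rw [PowerSeries.coeff_mul]
  exact summable_norm_sum_mul_antidiagonal_of_summable_norm (f := fun k => PowerSeries.coeff k φ)
    (g := fun k => PowerSeries.coeff k ψ) hφ hψ

theorem summable_norm_coeff_polynomial {R : Type*} [NormedCommRing R] (p : R[X]) :
    Summable fun k => ‖PowerSeries.coeff k (p : R⟦X⟧)‖ := by
  refine summable_of_ne_finset_zero (s := p.support) fun k hk => ?_
  simpa using hk

theorem inv_X_sub_C {ρ : ℂ} (hρ : ρ ≠ 0) :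
    (PowerSeries.X - PowerSeries.C ρ : ℂ⟦X⟧)⁻¹ = PowerSeries.mk fun k => -ρ⁻¹ ^ (k + 1) := by
  rw [PowerSeries.inv_eq_iff_mul_eq_one (by simpa using hρ)]
  ext k
  rw [mul_sub, map_sub, PowerSeries.coeff_mul_C, PowerSeries.coeff_mk]
  cases k with
  | zero => simp [hρ]
  | succ k =>
    rw [PowerSeries.coeff_succ_mul_X, PowerSeries.coeff_mk, PowerSeries.coeff_one]
    simp only [Nat.add_eq_zero_iff, one_ne_zero, and_false, if_false]
    rw [pow_succ _ (k + 1)]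
    field_simp
    ring

theorem summable_norm_coeff_inv_prod (m : Multiset ℂ) (hm : ∀ ρ ∈ m, 1 < ‖ρ‖) :
    Summable fun k => ‖PowerSeries.coeff k
      (((m.map fun ρ => Polynomial.X - Polynomial.C ρ).prod : ℂ[X]) : ℂ⟦X⟧)⁻¹‖ := by
  induction m using Multiset.induction_on with
  | empty =>
    have : (1 : ℂ⟦X⟧)⁻¹ = ((1 : ℂ[X]) : ℂ⟦X⟧) := by
      rw [PowerSeries.inv_eq_iff_mul_eq_one] <;> simp
    simp only [Multiset.map_zero, Multiset.prod_zero, Polynomial.coe_one]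
    rw [this]
    exact summable_norm_coeff_polynomial _
  | cons ρ m ih =>
    rw [Multiset.map_cons, Multiset.prod_cons, Polynomial.coe_mul, PowerSeries.mul_inv_rev]
    refine summable_norm_coeff_mul (ih fun x hx => hm x (Multiset.mem_cons_of_mem hx)) ?_
    have h1 : 1 < ‖ρ‖ := hm ρ (Multiset.mem_cons_self _ _)
    rw [Polynomial.coe_sub, Polynomial.coe_X, Polynomial.coe_C,
      inv_X_sub_C (norm_pos_iff.1 (by linarith))]
    simp only [PowerSeries.coeff_mk, norm_neg, norm_pow, norm_inv]
    exact (summable_nat_add_iff 1).2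
      (summable_geometric_of_lt_one (by positivity) (inv_lt_one_of_one_lt₀ h1))

/-- The reciprocal of a complex polynomial without zeros in the closed unit disc has absolutely
summable Maclaurin coefficients. -/
theorem summable_norm_coeff_inv_complex (q : ℂ[X]) (hq : ∀ z : ℂ, ‖z‖ ≤ 1 → q.eval z ≠ 0) :
    Summable fun k => ‖PowerSeries.coeff k (q : ℂ⟦X⟧)⁻¹‖ := by
  have hq0 : q ≠ 0 := by
    rintro rfl
    exact hq 0 (by simp) (by simp)
  have hl : q.leadingCoeff ≠ 0 := by simpa using hq0
  have hroots : ∀ ρ ∈ q.roots, 1 < ‖ρ‖ := by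
    intro ρ hρ
    by_contra h
    exact hq ρ (not_lt.1 h) ((Polynomial.mem_roots hq0).1 hρ)
  -- Each linear factor has a geometric series as reciprocal, with ratio `ρ⁻¹` inside the unit disc;
  -- ℓ¹ is closed under convolution.
  have hfac := (IsAlgClosed.splits q).eq_prod_roots
  rw [hfac, Polynomial.coe_mul, PowerSeries.mul_inv_rev]
  refine summable_norm_coeff_mul (summable_norm_coeff_inv_prod _ hroots) ?_
  have : ((Polynomial.C q.leadingCoeff : ℂ[X]) : ℂ⟦X⟧)⁻¹ =
      ((Polynomial.C q.leadingCoeff⁻¹ : ℂ[X]) : ℂ⟦X⟧) := by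
    rw [PowerSeries.inv_eq_iff_mul_eq_one (by simpa using hq0), ← Polynomial.coe_mul,
      ← Polynomial.C_mul, inv_mul_cancel₀ hl]
    simp
  rw [this]
  exact summable_norm_coeff_polynomial _

theorem summable_abs_coeff_inv {β : ℝ[X]} (hβ : ∀ z : ℂ, ‖z‖ ≤ 1 → Polynomial.aeval z β ≠ 0) :
    Summable fun k => |PowerSeries.coeff k (β : ℝ⟦X⟧)⁻¹| := by
  have h := summable_norm_coeff_inv_complex (β.map Complex.ofRealHom) fun z hz => by
    have := hβ z hz
    rwa [Polynomial.aeval_def, Polynomial.eval₂_eq_eval_map] at this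
  have hβ0 : PowerSeries.constantCoeff (β : ℝ⟦X⟧) ≠ 0 := by
    have := hβ 0 (by simp)
    simpa [Polynomial.coe_aeval_eq_eval, Polynomial.aeval_def, Polynomial.eval₂_at_zero] using this
  have hmap : ((β.map Complex.ofRealHom : ℂ[X]) : ℂ⟦X⟧)⁻¹ =
      PowerSeries.map Complex.ofRealHom (β : ℝ⟦X⟧)⁻¹ := by
    rw [PowerSeries.inv_eq_iff_mul_eq_one, Polynomial.polynomial_map_coe, ← map_mul,
      PowerSeries.inv_mul_cancel _ hβ0, map_one]
    rw [Polynomial.constantCoeff_coe, Polynomial.coeff_map]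
    rw [Polynomial.constantCoeff_coe] at hβ0
    simpa using hβ0
  rw [hmap] at h
  simpa using h

/-! ### Summability of `λ_{d,k}` -/

variable {α β : ℝ[X]} {d : ℝ} {s : ℕ}

theorem summable_comp_seasonalSeries {F : ℝ → ℝ} (hF : F 0 = 0) (hs : 1 ≤ s)
    (h : Summable fun k => F (fracCoeff d k)) :
    Summable fun k => F (PowerSeries.coeff k (seasonalSeries d s)) := by
  have hinj : Function.Injective fun q : ℕ => s * q :=
    fun a b h => Nat.eq_of_mul_eq_mul_left (by omega : 0 < s) h
  rw [← hinj.summable_iff]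
  · refine h.congr fun q => ?_
    simp [seasonalSeries, Nat.mul_div_cancel_left q (by omega : 0 < s)]
  · intro k hk
    have : ¬ s ∣ k := fun ⟨q, hq⟩ => hk ⟨q, hq.symm⟩
    simp [seasonalSeries, this, hF]

theorem summable_abs_coeff_rational (hβ : ∀ z : ℂ, ‖z‖ ≤ 1 → Polynomial.aeval z β ≠ 0) :
    Summable fun k => |PowerSeries.coeff k ((α : ℝ⟦X⟧) * (β : ℝ⟦X⟧)⁻¹)| :=
  summable_norm_coeff_mul (summable_norm_coeff_polynomial α) (summable_abs_coeff_inv hβ)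

theorem summable_abs_lam (hβ : ∀ z : ℂ, ‖z‖ ≤ 1 → Polynomial.aeval z β ≠ 0) (hs : 1 ≤ s)
    (hd : d ≤ 0) : Summable fun k => |lam α β d s k| := by
  have h : Summable fun k => |PowerSeries.coeff k (seasonalSeries d s)| :=
    summable_comp_seasonalSeries (F := fun x => |x|) abs_zero hs (summable_abs_fracCoeff hd)
  have h1 : Summable fun k => ‖PowerSeries.coeff k (lambdaSeries α β d s)‖ :=
    summable_norm_coeff_mul (summable_abs_coeff_rational hβ) h
  exact h1

theorem summable_sq_lam (hβ : ∀ z : ℂ, ‖z‖ ≤ 1 → Polynomial.aeval z β ≠ 0) (hs : 1 ≤ s)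
    (hd : d < 1 / 2) : Summable fun k => lam α β d s k ^ 2 := by
  have h : Summable fun k => PowerSeries.coeff k (seasonalSeries d s) ^ 2 :=
    summable_comp_seasonalSeries (F := fun x => x ^ 2) (by simp) hs (summable_sq_fracCoeff hd)
  have h1 := summable_sq_sum_antidiagonal (summable_abs_coeff_rational (α := α) hβ) h
  refine h1.congr fun n => ?_
  rw [← PowerSeries.coeff_mul]
  rfl

/-- Only multiples of `s` contribute to the seasonal factor, so each residue class reduces to a
convolution with the case `s = 1`. -/
theorem coeff_mul_seasonalSeries (p : ℝ[X]) {r : ℕ} (hr : r < s) (q : ℕ) :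
    PowerSeries.coeff (s * q + r) ((p : ℝ⟦X⟧) * seasonalSeries d s) =
      ∑ x ∈ Finset.HasAntidiagonal.antidiagonal q, p.coeff (s * x.1 + r) * fracCoeff d x.2 := by
  have hs : 0 < s := by omega
  rw [PowerSeries.coeff_mul]
  symm
  refine Finset.sum_of_injOn (fun x => (s * x.1 + r, s * x.2)) ?_ ?_ ?_ ?_
  · rintro ⟨a, b⟩ _ ⟨a', b'⟩ _ h
    simp only [Prod.mk.injEq, add_left_inj] at h
    exact Prod.ext (Nat.eq_of_mul_eq_mul_left hs h.1) (Nat.eq_of_mul_eq_mul_left hs h.2)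
  · rintro ⟨a, b⟩ h
    simp only [Finset.mem_coe, Finset.HasAntidiagonal.mem_antidiagonal] at h ⊢
    rw [← h]; ring
  · rintro ⟨i, j⟩ h hn
    rw [Finset.HasAntidiagonal.mem_antidiagonal] at h
    simp only at h
    by_cases hj : s ∣ j
    · exfalso
      obtain ⟨l, rfl⟩ := hj
      have hl : l ≤ q := by
        have h2 : s * l < s * (q + 1) := by rw [mul_add]; omega
        exact Nat.lt_succ_iff.1 (Nat.lt_of_mul_lt_mul_left h2)
      obtain ⟨m, rfl⟩ := Nat.exists_eq_add_of_le hl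
      refine hn ⟨(m, l), by simp [add_comm], ?_⟩
      rw [mul_add] at h
      simp only [Prod.mk.injEq, and_true]
      omega
    · simp [seasonalSeries, hj]
  · rintro ⟨a, b⟩ _
    simp [seasonalSeries, Nat.mul_div_cancel_left b hs]

theorem tendsto_fracCoeff_sub_div (hd : 0 < d) (m : ℕ) :
    Tendsto (fun q => fracCoeff d (q - m) / fracCoeff d q) atTop (𝓝 1) := by
  have h1 : Tendsto (fun q => fracCoeff d (q - 1) / fracCoeff d q) atTop (𝓝 1) := by
    rw [← tendsto_add_atTop_iff_nat 1]
    -- The shifted ratio is `(q + 1) / (q + d)`.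
    have h2 : Tendsto (fun q : ℕ => 1 + (1 - d) * ((q : ℝ) + d)⁻¹) atTop (𝓝 (1 + (1 - d) * 0)) :=
      tendsto_const_nhds.add (tendsto_const_nhds.mul
        (tendsto_inv_atTop_zero.comp (tendsto_natCast_atTop_atTop.atTop_add tendsto_const_nhds)))
    rw [mul_zero, add_zero] at h2
    refine h2.congr fun q => ?_
    have h3 := fracCoeff_succ d q
    have hq := fracCoeff_pos hd (q + 1)
    have hq' : (0 : ℝ) < q + d := by positivity
    rw [Nat.add_sub_cancel, eq_div_iff hq.ne']
    field_simp
    linarith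
  induction m with
  | zero =>
    refine tendsto_const_nhds.congr fun q => ?_
    rw [Nat.sub_zero, div_self (fracCoeff_pos hd q).ne']
  | succ m ih =>
    have := (ih.comp (tendsto_sub_atTop_nat 1)).mul h1
    rw [one_mul] at this
    refine this.congr fun q => ?_
    rw [Function.comp_apply, div_mul_div_cancel₀ (fracCoeff_pos hd _).ne',
      Nat.sub_sub, add_comm 1 m]

/-- Bounded shifts of `fracCoeff d` are asymptotically equal, so the convolution behaves like `A *
fracCoeff d q` and eventually its square is at least half of `A² * fracCoeff d q ^ 2`. -/
theorem summable_sq_fracCoeff_of_conv (hd : 0 < d) {a : ℕ → ℝ} {M : ℕ}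
    (haM : ∀ m, M ≤ m → a m = 0) (ha : ∑ m ∈ Finset.range M, a m ≠ 0)
    (h : Summable fun q => (∑ x ∈ Finset.HasAntidiagonal.antidiagonal q, a x.1 * fracCoeff d x.2) ^ 2) :
    Summable fun q => fracCoeff d q ^ 2 := by
  set A := ∑ m ∈ Finset.range M, a m
  have hlim : Tendsto (fun q => (∑ x ∈ Finset.HasAntidiagonal.antidiagonal q, a x.1 * fracCoeff d x.2) /
      fracCoeff d q) atTop (𝓝 A) := by
    have h1 : Tendsto (fun q => ∑ m ∈ Finset.range M, a m * (fracCoeff d (q - m) / fracCoeff d q))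
        atTop (𝓝 (∑ m ∈ Finset.range M, a m * 1)) :=
      tendsto_finsetSum _ fun m _ => tendsto_const_nhds.mul (tendsto_fracCoeff_sub_div hd m)
    simp only [mul_one] at h1
    refine h1.congr' ?_
    filter_upwards [eventually_ge_atTop M] with q hq
    rw [Finset.Nat.sum_antidiagonal_eq_sum_range_succ_mk, Finset.sum_div]
    simp only [mul_div_assoc]
    refine Finset.sum_subset (Finset.range_subset_range.2 (by omega)) fun m _ hm => ?_
    rw [haM m (by simpa using hm), zero_mul]
  have hev := (hlim.pow 2).eventually (lt_mem_nhds (by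
    have : 0 < A ^ 2 := by positivity
    linarith : A ^ 2 / 2 < A ^ 2))
  refine summable_of_isBigO_nat (h.mul_left (2 / A ^ 2)) (Asymptotics.IsBigO.of_bound 1 ?_)
  filter_upwards [hev] with q hq
  have hA : 0 < A ^ 2 := by positivity
  have hf := fracCoeff_pos hd q
  rw [div_pow, lt_div_iff₀ (by positivity)] at hq
  rw [one_mul, Real.norm_of_nonneg (by positivity), Real.norm_of_nonneg (by positivity),
    div_mul_eq_mul_div, le_div_iff₀ hA]
  linarith

theorem sum_range_mul_eq {R : Type*} [AddCommMonoid R] (f : ℕ → R) (s M : ℕ) :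
    ∑ i ∈ Finset.range (s * M), f i =
      ∑ r ∈ Finset.range s, ∑ m ∈ Finset.range M, f (s * m + r) := by
  induction M with
  | zero => simp
  | succ M ih =>
    rw [mul_add, mul_one, Finset.sum_range_add, ih, ← Finset.sum_add_distrib]
    exact Finset.sum_congr rfl fun r _ => (Finset.sum_range_succ _ _).symm

/-- If `α` does not vanish at some `s`-th root of unity, then the coefficients of `α` in some residue
class modulo `s` have non-zero sum. -/
theorem exists_residue_sum_ne_zero (hs : 1 ≤ s)
    (hα : ∃ z : ℂ, z ^ s = 1 ∧ Polynomial.aeval z α ≠ 0) :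
    ∃ r < s, ∑ m ∈ Finset.range (α.natDegree + 1), α.coeff (s * m + r) ≠ 0 := by
  obtain ⟨z, hz, hne⟩ := hα
  by_contra! h
  apply hne
  -- The range is padded to full blocks of length `s`; since `z ^ s = 1`, each class `r` contributes
  -- `z ^ r` times its coefficient sum.
  rw [Polynomial.aeval_eq_sum_range' (n := s * (α.natDegree + 1)) (by nlinarith),
    sum_range_mul_eq]
  refine Finset.sum_eq_zero fun r hr => ?_
  have h1 := h r (Finset.mem_range.1 hr)
  have h2 : ∀ m, α.coeff (s * m + r) • z ^ (s * m + r) = (α.coeff (s * m + r) : ℂ) * z ^ r := by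
    intro m
    rw [pow_add, pow_mul, hz, one_pow, one_mul, Complex.real_smul]
  simp_rw [h2]
  rw [← Finset.sum_mul, ← Complex.ofReal_sum, h1]
  simp

theorem not_summable_sq_lam (hβ0 : β.coeff 0 = 1) (hs : 1 ≤ s)
    (hα : ∃ z : ℂ, z ^ s = 1 ∧ Polynomial.aeval z α ≠ 0) (hd : 1 / 2 ≤ d) :
    ¬ Summable fun k => lam α β d s k ^ 2 := by
  intro h
  obtain ⟨r, hr, hsum⟩ := exists_residue_sum_ne_zero hs hα
  have h1 := summable_sq_sum_antidiagonal (summable_norm_coeff_polynomial β) h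
  have h2 : (β : ℝ⟦X⟧) * lambdaSeries α β d s = (α : ℝ⟦X⟧) * seasonalSeries d s := by
    have : (β : ℝ⟦X⟧) * (β : ℝ⟦X⟧)⁻¹ = 1 := PowerSeries.mul_inv_cancel _ (by simp [hβ0])
    rw [lambdaSeries, mul_assoc, mul_left_comm, ← mul_assoc (β : ℝ⟦X⟧), this, one_mul]
  simp only [lam, ← PowerSeries.coeff_mul, h2] at h1
  have h3 := h1.comp_injective (i := fun q => s * q + r) fun a b hab => by
    simpa [show s ≠ 0 by omega] using hab
  simp only [Function.comp_def, coeff_mul_seasonalSeries α hr] at h3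
  refine not_summable_sq_fracCoeff hd (summable_sq_fracCoeff_of_conv (by linarith) (fun m hm => ?_)
    hsum h3)
  refine Polynomial.coeff_eq_zero_of_natDegree_lt ?_
  nlinarith

end SFIEGARCH

/-! ### Almost sure convergence of independent series -/

namespace SFIEGARCH

section RandomSeries

variable {Ω : Type*} [MeasurableSpace Ω] {μ : Measure Ω} [IsProbabilityMeasure μ]
  {Y : ℕ → Ω → ℝ} {a : ℕ → ℝ}

/-- The partial sums of independent centered integrable random variables form a martingale. -/
theorem martingale_sum (hm : ∀ k, StronglyMeasurable (Y k)) (hi : ∀ k, Integrable (Y k) μ)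
    (hind : iIndepFun Y μ) (h0 : ∀ k, ∫ x, Y k x ∂μ = 0) :
    Martingale (fun n => ∑ k ∈ Finset.range (n + 1), Y k) (Filtration.natural Y hm) μ := by
  have hadp : ∀ n, StronglyMeasurable[Filtration.natural Y hm n]
      (∑ k ∈ Finset.range (n + 1), Y k) := fun n =>
    Finset.stronglyMeasurable_sum _ fun k hk =>
      (Filtration.stronglyAdapted_natural hm k).mono
        ((Filtration.natural Y hm).mono (Nat.lt_succ_iff.1 (Finset.mem_range.1 hk)))
  have hint : ∀ n, Integrable (∑ k ∈ Finset.range (n + 1), Y k) μ := fun n =>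
    integrable_finsetSum' _ fun k _ => hi k
  refine martingale_of_condExp_sub_eq_zero_nat hadp hint fun n => ?_
  have : (∑ k ∈ Finset.range (n + 1 + 1), Y k) - ∑ k ∈ Finset.range (n + 1), Y k = Y (n + 1) := by
    rw [Finset.sum_range_succ _ (n + 1), add_sub_cancel_left]
  rw [this]
  filter_upwards [hind.condExp_natural_ae_eq_of_lt hm (Nat.lt_succ_self n)] with x hx
  rw [hx, h0]
  rfl

/-- A series of independent centered random variables with summable variances converges almost
surely. -/
theorem ae_exists_tendsto_sum (hm : ∀ k, Measurable (Y k)) (hL : ∀ k, MemLp (Y k) 2 μ)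
    (hind : iIndepFun Y μ) (h0 : ∀ k, ∫ x, Y k x ∂μ = 0)
    (hv : Summable fun k => variance (Y k) μ) :
    ∀ᵐ x ∂μ, ∃ l, Tendsto (fun n => ∑ k ∈ Finset.range n, Y k x) atTop (𝓝 l) := by
  have hM := martingale_sum (fun k => (hm k).stronglyMeasurable)
    (fun k => (hL k).integrable (by norm_num)) hind h0
  have hLp : ∀ n, MemLp (∑ k ∈ Finset.range (n + 1), Y k) 2 μ := fun n =>
    memLp_finsetSum' _ fun k _ => hL k
  have hvar : ∀ n, variance (∑ k ∈ Finset.range (n + 1), Y k) μ ≤ ∑' k, variance (Y k) μ := by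
    intro n
    rw [IndepFun.variance_sum (fun k _ => hL k) fun i _ j _ hij => hind.indepFun hij]
    exact hv.sum_le_tsum _ fun k _ => variance_nonneg _ _
  -- Martingale convergence needs an L¹ bound, obtained from the L² norm, here the root of the
  -- variance.
  have hbdd : ∀ n, eLpNorm (∑ k ∈ Finset.range (n + 1), Y k) 1 μ ≤
      ((Real.sqrt (∑' k, variance (Y k) μ)).toNNReal : ENNReal) := by
    intro n
    refine (eLpNorm_le_eLpNorm_of_exponent_le (q := 2) (by norm_num) (hLp n).1).trans ?_
    have hmean : ∫ x, (∑ k ∈ Finset.range (n + 1), Y k) x ∂μ = 0 := by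
      simp only [Finset.sum_apply]
      rw [integral_finsetSum _ fun k _ => (hL k).integrable (by norm_num)]
      exact Finset.sum_eq_zero fun k _ => h0 k
    have h2 : variance (∑ k ∈ Finset.range (n + 1), Y k) μ =
        ∫ x, (∑ k ∈ Finset.range (n + 1), Y k) x ^ 2 ∂μ :=
      variance_of_integral_eq_zero (hLp n).1.aemeasurable hmean
    rw [(hLp n).eLpNorm_eq_integral_rpow_norm (by norm_num) (by norm_num)]
    refine ENNReal.ofReal_le_ofReal ?_
    rw [Real.sqrt_eq_rpow]
    simp only [ENNReal.toReal_ofNat, Real.rpow_ofNat, Real.norm_eq_abs, sq_abs]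
    rw [← h2, one_div]
    exact Real.rpow_le_rpow (variance_nonneg _ _) (hvar n) (by norm_num)
  filter_upwards [hM.submartingale.exists_ae_tendsto_of_bdd hbdd] with x ⟨l, hl⟩
  refine ⟨l, (tendsto_add_atTop_iff_nat 1).1 ?_⟩
  simpa [Finset.sum_apply] using hl

/-- Near the origin, the characteristic function of a non-degenerate centered random variable is
bounded by `1 - c t²`. -/
theorem exists_norm_charFun_le {X : Ω → ℝ} (hX : AEMeasurable X μ)
    (h0 : ∫ x, X x ∂μ = 0) (hv : 0 < variance X μ) :
    ∃ c > 0, ∃ δ > 0, ∀ t : ℝ, |t| ≤ δ → ‖charFun (μ.map X) t‖ ≤ 1 - c * t ^ 2 := by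
  set v := variance X μ with hvdef
  set r := Real.sqrt v with hr
  have hr0 : 0 < r := Real.sqrt_pos.2 hv
  have hr2 : r ^ 2 = v := Real.sq_sqrt hv.le
  have hX' : AEMeasurable (fun x => r⁻¹ * X x) μ := hX.const_mul _
  have h1 : ∫ x, r⁻¹ * X x ∂μ = 0 := by rw [integral_const_mul, h0, mul_zero]
  have h2 : ∫ x, ((fun x => r⁻¹ * X x) ^ 2) x ∂μ = 1 := by
    have : v = ∫ x, X x ^ 2 ∂μ := variance_of_integral_eq_zero hX h0
    simp only [Pi.pow_apply, mul_pow]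
    rw [integral_const_mul, ← this, ← hr2]
    field_simp
  -- An error of at most a quarter of the square turns `1 - (r t)² / 2` into `1 - (r t)² / 4`,
  -- whence `c = v / 4`. Capping at `1` below keeps `1 - (r t)² / 2` nonnegative.
  have ht := (taylor_charFun_two hX' h1 h2).bound (c := 1 / 4) (by norm_num)
  obtain ⟨δ, hδ, hball⟩ := Metric.eventually_nhds_iff_ball.1 ht
  have hmin : 0 < min δ 1 := lt_min hδ one_pos
  refine ⟨v / 4, by positivity, min δ 1 / (2 * r), by positivity, fun t htt => ?_⟩
  have hrt : |r * t| ≤ min δ 1 / 2 := by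
    rw [abs_mul, abs_of_pos hr0]
    calc r * |t| ≤ r * (min δ 1 / (2 * r)) := by gcongr
      _ = _ := by field_simp
  have hb := hball (r * t) (by
    rw [mem_ball_zero_iff, Real.norm_eq_abs]
    have := min_le_left δ 1
    linarith)
  have hc : charFun (μ.map fun x => r⁻¹ * X x) (r * t) = charFun (μ.map X) t := by
    rw [charFun_map_mul_comp hX, ← mul_assoc, inv_mul_cancel₀ hr0.ne', one_mul]
  rw [hc] at hb
  have hsmall : (r * t) ^ 2 ≤ 1 := by
    rw [← sq_abs]
    have := min_le_right δ 1
    have : |r * t| ≤ 1 := by linarith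
    exact pow_le_one₀ (abs_nonneg _) this
  have hnorm : ‖(1 - ((r * t : ℝ) : ℂ) ^ 2 / 2)‖ = 1 - (r * t) ^ 2 / 2 := by
    have : (1 - ((r * t : ℝ) : ℂ) ^ 2 / 2) = ((1 - (r * t) ^ 2 / 2 : ℝ) : ℂ) := by push_cast; ring
    rw [this, Complex.norm_real, Real.norm_of_nonneg (by linarith)]
  have htri := norm_le_norm_sub_add (charFun (μ.map X) t) (1 - ((r * t : ℝ) : ℂ) ^ 2 / 2)
  rw [hnorm] at htri
  rw [Real.norm_of_nonneg (sq_nonneg (r * t))] at hb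
  have : (r * t) ^ 2 = v * t ^ 2 := by rw [mul_pow, hr2]
  rw [this] at htri hb
  linarith

/-- If `∑ aₖ Yₖ` converges almost surely, where the `Yₖ` are non-degenerate and identically
distributed, then `(aₖ)` is eventually bounded by one. -/
theorem eventually_abs_le_one (hm : ∀ k, Measurable (Y k)) (hid : ∀ k, IdentDistrib (Y k) (Y 0) μ μ)
    (hv : 0 < variance (Y 0) μ)
    (h : ∀ᵐ x ∂μ, ∃ l, Tendsto (fun n => ∑ k ∈ Finset.range n, a k * Y k x) atTop (𝓝 l)) :
    ∀ᶠ k in atTop, |a k| ≤ 1 := by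
  obtain ⟨ε, hε, hp⟩ : ∃ ε : ℝ, 0 < ε ∧ μ {x | ε ≤ |Y 0 x|} ≠ 0 := by
    by_contra! hcon
    have hae : ∀ᵐ x ∂μ, ∀ n : ℕ, |Y 0 x| < 1 / ((n : ℝ) + 1) := by
      refine ae_all_iff.2 fun n => ?_
      have := hcon (1 / ((n : ℝ) + 1)) (by positivity)
      rw [ae_iff]
      simpa only [not_lt] using this
    have hz : Y 0 =ᵐ[μ] 0 := by
      filter_upwards [hae] with x hx
      have hle : |Y 0 x| ≤ 0 :=
        ge_of_tendsto' (tendsto_one_div_add_atTop_nhds_zero_nat (𝕜 := ℝ)) fun n => (hx n).le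
      exact abs_nonpos_iff.1 hle
    rw [variance_congr hz, variance_zero] at hv
    exact lt_irrefl _ hv
  -- Terms of a convergent series tend to zero in measure, but `|a k| > 1` would keep the
  -- probability of `ε ≤ |a k * Y k|` at or above that of `ε ≤ |Y 0|`.
  have hlim : ∀ᵐ x ∂μ, Tendsto (fun k => a k * Y k x) atTop (𝓝 0) := by
    filter_upwards [h] with x ⟨l, hl⟩
    have := (hl.comp (tendsto_add_atTop_nat 1)).sub hl
    rw [sub_self] at this
    refine this.congr fun n => ?_
    rw [Function.comp_apply, Finset.sum_range_succ, add_sub_cancel_left]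
  have hmeas := tendstoInMeasure_of_tendsto_ae (g := fun _ => (0 : ℝ))
    (fun k => ((hm k).const_mul (a k)).aestronglyMeasurable) hlim
  have hev := (tendstoInMeasure_iff_norm.1 hmeas ε hε).eventually
    (gt_mem_nhds (pos_iff_ne_zero.2 hp))
  filter_upwards [hev] with k hk
  by_contra hak
  refine absurd hk (not_lt.2 ?_)
  have hpk : μ {x | ε ≤ |Y k x|} = μ {x | ε ≤ |Y 0 x|} :=
    (hid k).measure_mem_eq (s := {y | ε ≤ |y|}) (measurableSet_le measurable_const measurable_norm)
  rw [← hpk]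
  refine measure_mono fun x hx => ?_
  have hx' : ε ≤ |Y k x| := hx
  change ε ≤ ‖a k * Y k x - 0‖
  rw [sub_zero, norm_mul, Real.norm_eq_abs, Real.norm_eq_abs]
  exact hx'.trans (le_mul_of_one_le_left (abs_nonneg _) (not_le.1 hak).le)

/-- If the partial sums of independent random variables converge almost surely, then near the
origin the products of their characteristic functions stay away from zero. -/
theorem exists_half_le_prod_norm_charFun (hm : ∀ k, Measurable (Y k)) (hind : iIndepFun Y μ)
    (h : ∀ᵐ x ∂μ, ∃ l, Tendsto (fun n => ∑ k ∈ Finset.range n, Y k x) atTop (𝓝 l)) :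
    ∃ δ > 0, ∀ u : ℝ, |u| < δ → ∀ n,
      1 / 2 ≤ ∏ k ∈ Finset.range n, ‖charFun (μ.map (Y k)) u‖ := by
  have hSm : ∀ n, Measurable fun x => ∑ k ∈ Finset.range n, Y k x := fun n =>
    Finset.measurable_sum _ fun k _ => hm k
  obtain ⟨S, hS, hlim⟩ := measurable_limit_of_tendsto_metrizable_ae
    (fun n => (hSm n).aemeasurable) h
  have : IsProbabilityMeasure (μ.map S) := Measure.isProbabilityMeasure_map hS.aemeasurable
  have hcont : Tendsto (fun u => ‖charFun (μ.map S) u‖) (𝓝 0) (𝓝 1) := by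
    have := (continuous_charFun (μ := μ.map S)).norm.tendsto 0
    simpa using this
  obtain ⟨δ, hδ, hball⟩ := Metric.eventually_nhds_iff_ball.1
    (hcont.eventually (lt_mem_nhds (by norm_num : (1 / 2 : ℝ) < 1)))
  refine ⟨δ, hδ, fun u hu n => ?_⟩
  have hhalf := hball u (by simpa using hu)
  have hconv : Tendsto (fun n => ∏ k ∈ Finset.range n, ‖charFun (μ.map (Y k)) u‖) atTop
      (𝓝 ‖charFun (μ.map S) u‖) := by
    have h1 : Tendsto (fun n => charFun (μ.map fun x => ∑ k ∈ Finset.range n, Y k x) u) atTop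
        (𝓝 (charFun (μ.map S) u)) := by
      have hrw : ∀ {f : Ω → ℝ}, Measurable f →
          charFun (μ.map f) u = ∫ x, Complex.exp (u * f x * Complex.I) ∂μ := by
        intro f hf
        rw [charFun_apply_real, integral_map hf.aemeasurable (by fun_prop)]
      simp_rw [hrw (hSm _)]
      rw [hrw hS]
      refine tendsto_integral_of_dominated_convergence (fun _ => 1) (fun n => ?_)
        (integrable_const _) (fun n => ?_) ?_
      · exact (by fun_prop : Continuous fun y : ℝ => Complex.exp (u * y * Complex.I)).measurable.comp
          (hSm n) |>.aestronglyMeasurable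
      · refine ae_of_all _ fun x => ?_
        rw [← Complex.ofReal_mul, Complex.norm_exp_ofReal_mul_I]
      · filter_upwards [hlim] with x hx
        exact ((by fun_prop : Continuous fun y : ℝ => Complex.exp (u * y * Complex.I)).tendsto
          (S x)).comp hx
    refine h1.norm.congr fun n => ?_
    rw [iIndepFun.charFun_map_fun_finsetSum_eq_prod (fun k _ => (hm k).aemeasurable)
      (hind.restrict _), Finset.prod_apply, norm_prod]
  -- A decreasing product dominates its limit, which exceeds `1 / 2` near the origin by continuity.
  have hanti : Antitone fun n => ∏ k ∈ Finset.range n, ‖charFun (μ.map (Y k)) u‖ := by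
    refine antitone_nat_of_succ_le fun n => ?_
    have : IsProbabilityMeasure (μ.map (Y n)) :=
      Measure.isProbabilityMeasure_map (hm n).aemeasurable
    rw [Finset.prod_range_succ]
    exact mul_le_of_le_one_right (Finset.prod_nonneg fun _ _ => norm_nonneg _)
      (norm_charFun_le_one _)
  exact hhalf.le.trans (hanti.le_of_tendsto hconv n)

/-- If `∑ aₖ Yₖ` converges almost surely, where the `Yₖ` are non-degenerate, centered, independent
and identically distributed, then `∑ aₖ² < ∞`. -/
theorem summable_sq_of_ae_tendsto (hm : ∀ k, Measurable (Y k)) (hind : iIndepFun Y μ)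
    (hid : ∀ k, IdentDistrib (Y k) (Y 0) μ μ)
    (hv : 0 < variance (Y 0) μ) (h0 : ∫ x, Y 0 x ∂μ = 0)
    (h : ∀ᵐ x ∂μ, ∃ l, Tendsto (fun n => ∑ k ∈ Finset.range n, a k * Y k x) atTop (𝓝 l)) :
    Summable fun k => a k ^ 2 := by
  obtain ⟨N, hN⟩ := eventually_atTop.1 (eventually_abs_le_one hm hid hv h)
  obtain ⟨c, hc, δ₁, hδ₁, hφ⟩ := exists_norm_charFun_le (hm 0).aemeasurable h0 hv
  obtain ⟨δ₂, hδ₂, hprod⟩ := exists_half_le_prod_norm_charFun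
    (fun k => (hm k).const_mul (a k))
    (hind.comp (fun k y => a k * y) fun k => measurable_const_mul (a k)) h
  -- With `|a k| ≤ 1`, this keeps `a k * u` in the range of the quadratic bound; halving `δ₂` gives
  -- the strict inequality.
  set u := min δ₁ (δ₂ / 2) with hu
  have hu0 : 0 < u := lt_min hδ₁ (by positivity)
  have hbound : ∀ k, N ≤ k → ‖charFun (μ.map fun x => a k * Y k x) u‖ ≤
      Real.exp (-(c * u ^ 2 * a k ^ 2)) := by
    intro k hk
    rw [charFun_map_mul_comp (hm k).aemeasurable, (hid k).map_eq]
    refine (hφ (a k * u) ?_).trans ?_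
    · rw [abs_mul, abs_of_pos hu0]
      exact (mul_le_of_le_one_left hu0.le (hN k hk)).trans (min_le_left _ _)
    · have := Real.add_one_le_exp (-(c * u ^ 2 * a k ^ 2))
      nlinarith
  have hone : ∀ k, ‖charFun (μ.map fun x => a k * Y k x) u‖ ≤ 1 := fun k => by
    have : IsProbabilityMeasure (μ.map fun x => a k * Y k x) :=
      Measure.isProbabilityMeasure_map ((hm k).const_mul (a k)).aemeasurable
    exact norm_charFun_le_one _
  rw [← summable_nat_add_iff N]
  have hcu : 0 < c * u ^ 2 := by positivity
  refine summable_of_sum_range_le (c := Real.log 2 / (c * u ^ 2)) (fun _ => sq_nonneg _) fun n => ?_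
  have h1 := hprod u (by
    rw [abs_of_pos hu0]
    exact (min_le_right _ _).trans_lt (by linarith)) (N + n)
  rw [Finset.prod_range_add] at h1
  -- The first `N` factors are at most one and can be dropped; a logarithm then bounds the sum
  -- uniformly in `n`.
  have h2 : (1 / 2 : ℝ) ≤ Real.exp (-(c * u ^ 2 * ∑ i ∈ Finset.range n, a (i + N) ^ 2)) := by
    refine h1.trans ?_
    rw [Finset.mul_sum, ← Finset.sum_neg_distrib, Real.exp_sum]
    refine (mul_le_of_le_one_left (Finset.prod_nonneg fun _ _ => norm_nonneg _)
      (Finset.prod_le_one (fun _ _ => norm_nonneg _) fun k _ => hone k)).trans ?_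
    refine Finset.prod_le_prod (fun _ _ => norm_nonneg _) fun k _ => ?_
    rw [add_comm k N]
    exact hbound (N + k) (Nat.le_add_right _ _)
  have h3 := Real.log_le_log (by norm_num) h2
  rw [Real.log_exp, one_div, Real.log_inv] at h3
  rw [le_div_iff₀ hcu]
  linarith

end RandomSeries

/-- Absolutely summable multiples of identically distributed integrable random variables form an
absolutely convergent series almost surely. -/
theorem ae_summable_abs_mul {Ω : Type*} [MeasurableSpace Ω] {μ : Measure Ω} {Y : ℕ → Ω → ℝ}
    {a : ℕ → ℝ} (hid : ∀ k, IdentDistrib (Y k) (Y 0) μ μ) (hi : Integrable (Y 0) μ)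
    (ha : Summable fun k => |a k|) : ∀ᵐ x ∂μ, Summable fun k => |a k * Y k x| := by
  have hint : ∀ k, Integrable (Y k) μ := fun k => (hid k).integrable_iff.2 hi
  have hnorm : ∀ k, eLpNorm (fun x => a k * Y k x) 1 μ = ‖a k‖ₑ * eLpNorm (Y 0) 1 μ := fun k => by
    rw [← (hid k).eLpNorm_eq]
    exact eLpNorm_const_smul (a k) (Y k) 1 μ
  have hne : ∑' k, eLpNorm (fun x => a k * Y k x) 1 μ ≠ ⊤ := by
    simp_rw [hnorm]
    rw [ENNReal.tsum_mul_right]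
    exact ENNReal.mul_ne_top (tsum_enorm_ne_top_iff_summable_norm.2 ha)
      (memLp_one_iff_integrable.2 hi).eLpNorm_ne_top
  have hsum : ∀ᵐ x ∂μ, Summable fun k => ‖a k * Y k x‖ :=
    summable_norm_of_tsum_eLpNorm_ne_top le_rfl
      (fun k => ((hint k).const_mul (a k)).aestronglyMeasurable) hne
  simpa only [Real.norm_eq_abs] using hsum

end SFIEGARCH

/-! ### The noise `g(Z_t)` and the process -/

namespace SFIEGARCH

section Noise

variable {Ω : Type*} [MeasurableSpace Ω] {μ : Measure Ω} {Z : ℤ → Ω → ℝ} {θ γ : ℝ}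

/-- With `E|Z_t|` replaced by `E|Z_0|`, one fixed function acts on every `Z_t`, so the i.i.d.
property passes to the noise. -/
theorem gNoise_eq_comp (hZ : IsInnovation Z μ) (t : ℤ) :
    gNoise μ Z θ γ t = (fun z => θ * z + γ * (|z| - ∫ y, |Z 0 y| ∂μ)) ∘ Z t := by
  have h : ∫ y, |Z t y| ∂μ = ∫ y, |Z 0 y| ∂μ := (hZ.identDistrib t).norm.integral_eq
  funext x
  simp only [gNoise, Function.comp_apply, h]

theorem measurable_gNoise (hZ : IsInnovation Z μ) (t : ℤ) : Measurable (gNoise μ Z θ γ t) := by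
  have := hZ.measurable t
  unfold gNoise
  fun_prop

theorem identDistrib_gNoise (hZ : IsInnovation Z μ) (t : ℤ) :
    IdentDistrib (gNoise μ Z θ γ t) (gNoise μ Z θ γ 0) μ μ := by
  rw [gNoise_eq_comp hZ, gNoise_eq_comp hZ]
  exact (hZ.identDistrib t).comp (by fun_prop)

theorem iIndepFun_gNoise (hZ : IsInnovation Z μ) : iIndepFun (gNoise μ Z θ γ) μ := by
  have h : gNoise μ Z θ γ = fun t => (fun z => θ * z + γ * (|z| - ∫ y, |Z 0 y| ∂μ)) ∘ Z t :=
    funext fun t => gNoise_eq_comp hZ t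
  rw [h]
  exact hZ.indep.comp _ fun t => by fun_prop

theorem iIndepFun_gNoise_past (hZ : IsInnovation Z μ) (t : ℤ) :
    iIndepFun (fun k : ℕ => gNoise μ Z θ γ (t - 1 - k)) μ :=
  (iIndepFun_gNoise hZ).precomp (g := fun k : ℕ => t - 1 - k) fun a b h => by
    simpa using h

theorem identDistrib_gNoise_past (hZ : IsInnovation Z μ) (t : ℤ) (k : ℕ) :
    IdentDistrib (gNoise μ Z θ γ (t - 1 - k)) (gNoise μ Z θ γ (t - 1 - (0 : ℕ))) μ μ :=
  (identDistrib_gNoise hZ _).trans (identDistrib_gNoise hZ _).symm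

variable {α β : ℝ[X]} {s : ℕ} {d ω : ℝ}

/-- If all the series `∑ λ_k g(Z_{t-1-k})` converge almost surely, then an SFIEGARCH process
exists. -/
theorem exists_isSFIEGARCH (hZ : IsInnovation Z μ)
    (h : ∀ t : ℤ, ∀ᵐ x ∂μ, ∃ l : ℝ,
      SeriesTendsto (fun k => logVolTerm μ Z α β s d θ γ t k x) l) :
    ∃ X : ℤ → Ω → ℝ, IsSFIEGARCH μ Z α β s d θ γ ω X := by
  have hS : ∀ t : ℤ, ∃ S : Ω → ℝ, Measurable S ∧
      ∀ᵐ x ∂μ, SeriesTendsto (fun k => logVolTerm μ Z α β s d θ γ t k x) (S x) := fun t =>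
    measurable_limit_of_tendsto_metrizable_ae (fun n => (Finset.measurable_sum _ fun k _ =>
      (measurable_gNoise hZ _).const_mul _).aemeasurable) (h t)
  choose S hSm hS using hS
  -- This choice of `σ` solves `ln σ² = ω + S`, with `S` a measurable version of the limit.
  have hσ : ∀ t, Measurable fun x => Real.exp ((ω + S t x) / 2) := fun t => by
    have := hSm t
    fun_prop
  refine ⟨fun t x => Real.exp ((ω + S t x) / 2) * Z t x, fun t => (hσ t).mul (hZ.measurable t),
    fun t x => Real.exp ((ω + S t x) / 2), hσ, fun t => ?_⟩
  filter_upwards [hS t] with x hx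
  refine ⟨Real.exp_pos _, rfl, ?_⟩
  rw [Real.log_pow, Real.log_exp]
  convert hx using 1
  push_cast
  ring

variable [IsProbabilityMeasure μ]

theorem memLp_gNoise (hZ : IsInnovation Z μ) (t : ℤ) : MemLp (gNoise μ Z θ γ t) 2 μ :=
  ((hZ.memLp t).const_mul θ).add (((hZ.memLp t).norm.sub (memLp_const _)).const_mul γ)

theorem integral_gNoise (hZ : IsInnovation Z μ) (t : ℤ) : ∫ x, gNoise μ Z θ γ t x ∂μ = 0 := by
  have hi : Integrable (Z t) μ := (hZ.memLp t).integrable (by norm_num)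
  have ha : Integrable (fun x => |Z t x|) μ := hi.norm
  unfold gNoise
  have hc : Integrable (fun x => |Z t x| - ∫ y, |Z t y| ∂μ) μ := ha.sub (integrable_const _)
  rw [integral_add (hi.const_mul θ) (hc.const_mul γ), integral_const_mul, integral_const_mul, integral_sub ha (integrable_const _), hZ.mean t]
  simp

theorem ae_exists_seriesTendsto (hZ : IsInnovation Z μ)
    (hl : Summable fun k => lam α β d s k ^ 2) (t : ℤ) :
    ∀ᵐ x ∂μ, ∃ l : ℝ, SeriesTendsto (fun k => logVolTerm μ Z α β s d θ γ t k x) l := by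
  refine ae_exists_tendsto_sum (Y := fun k => logVolTerm μ Z α β s d θ γ t k)
    (fun k => (measurable_gNoise hZ _).const_mul _) (fun k => (memLp_gNoise hZ _).const_mul _)
    ((iIndepFun_gNoise_past hZ t).comp (fun k y => lam α β d s k * y)
      fun k => measurable_const_mul _) (fun k => ?_) ?_
  · unfold logVolTerm
    rw [integral_const_mul, integral_gNoise hZ, mul_zero]
  · refine (hl.mul_right (variance (gNoise μ Z θ γ 0) μ)).congr fun k => ?_
    unfold logVolTerm
    rw [variance_const_mul, (identDistrib_gNoise hZ (t - 1 - k)).variance_eq]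

theorem summable_sq_lam_of_ae_seriesTendsto (hZ : IsInnovation Z μ)
    (hv : 0 < variance (gNoise μ Z θ γ 0) μ) (t : ℤ)
    (h : ∀ᵐ x ∂μ, ∃ l : ℝ, SeriesTendsto (fun k => logVolTerm μ Z α β s d θ γ t k x) l) :
    Summable fun k => lam α β d s k ^ 2 :=
  summable_sq_of_ae_tendsto (Y := fun k : ℕ => gNoise μ Z θ γ (t - 1 - k))
    (fun k => measurable_gNoise hZ _) (iIndepFun_gNoise_past hZ t) (identDistrib_gNoise_past hZ t)
    (by rwa [(identDistrib_gNoise hZ _).variance_eq]) (integral_gNoise hZ _) h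

end Noise

end SFIEGARCH

theorem lemma1 {Ω : Type*} [MeasurableSpace Ω] (μ : Measure Ω) [IsProbabilityMeasure μ]
    (Z : ℤ → Ω → ℝ) (hZ : SFIEGARCH.IsInnovation Z μ)
    (α β : ℝ[X]) (hα0 : α.coeff 0 = 1) (hβ0 : β.coeff 0 = 1)
    (hcommon : ∀ z : ℂ, ¬ (Polynomial.aeval z α = 0 ∧ Polynomial.aeval z β = 0))
    (hβ : ∀ z : ℂ, ‖z‖ ≤ 1 → Polynomial.aeval z β ≠ 0)
    (s : ℕ) (hs : 1 ≤ s) (d θ γ ω : ℝ) :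
    -- the equivalences, when `Var g(Z_0) ≠ 0` and `α` does not vanish at all `s`-th roots of unity
    (0 < variance (SFIEGARCH.gNoise μ Z θ γ 0) μ →
      (∃ z : ℂ, z ^ s = 1 ∧ Polynomial.aeval z α ≠ 0) →
        (∀ t : ℤ, (∀ᵐ x ∂μ, ∃ l : ℝ,
          SFIEGARCH.SeriesTendsto (fun k => SFIEGARCH.logVolTerm μ Z α β s d θ γ t k x) l) ↔
            d < 1 / 2) ∧
        ((∃ X : ℤ → Ω → ℝ, SFIEGARCH.IsSFIEGARCH μ Z α β s d θ γ ω X) ↔ d < 1 / 2)) ∧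
    -- sufficiency of `d < 1 / 2`, without these two conditions
    (d < 1 / 2 →
      (∀ t : ℤ, ∀ᵐ x ∂μ, ∃ l : ℝ,
        SFIEGARCH.SeriesTendsto (fun k => SFIEGARCH.logVolTerm μ Z α β s d θ γ t k x) l) ∧
      ∃ X : ℤ → Ω → ℝ, SFIEGARCH.IsSFIEGARCH μ Z α β s d θ γ ω X) ∧
    -- absolute convergence
    (d ≤ 0 → ∀ t : ℤ, ∀ᵐ x ∂μ,
      Summable fun k => |SFIEGARCH.logVolTerm μ Z α β s d θ γ t k x|) := by
  have hconv : d < 1 / 2 → ∀ t : ℤ, ∀ᵐ x ∂μ, ∃ l : ℝ,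
      SFIEGARCH.SeriesTendsto (fun k => SFIEGARCH.logVolTerm μ Z α β s d θ γ t k x) l :=
    fun hd => SFIEGARCH.ae_exists_seriesTendsto hZ (SFIEGARCH.summable_sq_lam hβ hs hd)
  refine ⟨fun hv hα => ?_, fun hd => ⟨hconv hd, SFIEGARCH.exists_isSFIEGARCH hZ (hconv hd)⟩,
    fun hd t => ?_⟩
  · have hnec : ∀ t : ℤ, (∀ᵐ x ∂μ, ∃ l : ℝ,
        SFIEGARCH.SeriesTendsto (fun k => SFIEGARCH.logVolTerm μ Z α β s d θ γ t k x) l) →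
        d < 1 / 2 := fun t h => by
      by_contra hd
      exact SFIEGARCH.not_summable_sq_lam hβ0 hs hα (not_lt.1 hd)
        (SFIEGARCH.summable_sq_lam_of_ae_seriesTendsto hZ hv t h)
    refine ⟨fun t => ⟨hnec t, fun hd => hconv hd t⟩, fun ⟨X, _, σ, _, h⟩ => hnec 0 ?_,
      fun hd => SFIEGARCH.exists_isSFIEGARCH hZ (hconv hd)⟩
    filter_upwards [h 0] with x hx
    exact ⟨_, hx.2.2⟩
  · exact SFIEGARCH.ae_summable_abs_mul (SFIEGARCH.identDistrib_gNoise_past hZ t)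
      ((SFIEGARCH.memLp_gNoise hZ _).integrable (by norm_num))
      (SFIEGARCH.summable_abs_lam hβ hs hd)
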